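/- Let $n>1$ be an odd integer, let $k\ge 1$, and let $T_n$ be the Chebyshev polynomial of the first kind of degree $n$ ($T_0=1$, $T_1=x$, $T_m=2xT_{m-1}-T_{m-2}$), viewed as a map $\mathbb{Z}_{2^k}\to\mathbb{Z}_{2^k}$ on $\mathbb{Z}_{2^k}=\mathbb{Z}/2^k\mathbb{Z}$. Its functional graph $\mathcal{G}(T_n/\mathbb{Z}_{2^k})$ has vertex set $\mathbb{Z}_{2^k}$ (the states) and an arrow $x\to T_n(x)$ for every $x$. A state is odd if its representative in $\{0,\dots,2^k-1\}$ is odd. Write $\nu_2$ for the $2$-adic valuation, $w=\max\{\nu_2(n-1),\nu_2(n+1)\}$, and $A_i=\{0,1,\dots,2^i-1\}$. (a) If $k\ge w+3$, then the odd states form a disjoint union of connected components of the functional graph, each of which is a bare directed cycle (with nothing attached). For each $t=1,\dots,k-w-3$ exactly $2^{w+1}$ of these cycles have length $2^t$, exactly $2^{w+2}$ of them are self-loops (cycles of length $1$), and there are no others. Moreover, for each $t=1,\dots,k-w-3$, the $2^{w+1}$ cycles of length $2^t$ are exactly the sets of residues modulo $2^k$ $$\{2^{k-w-t-1}+\varepsilon+2^{k-w-t}j_1+2^{k-t}j_2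 : j_2\in A_t\},\qquad \varepsilon\in\{1,-1\},\ j_1\in A_w,$$ and the $2^{w+2}$ self-loops are exactly the states $$\{1+2^{k-w-1}j : j\in A_{w+1}\}\cup\{(j+1)2^{k-w-1}-1 : j\in A_{w+1}\}.$$ (b) If $k<w+3$, then every odd state is a fixed point of $T_n$; that is, the odd states form $2^{k-1}$ self-loops. -/

import Mathlib

namespace ChebGraph

/-- The map `x ↦ T_n(x)` on `ℤ / 2^k`, where `T_n` is the Chebyshev polynomial of the first kind. -/
noncomputable def chebMap (n k : ℕ) (x : ZMod (2 ^ k)) : ZMod (2 ^ k) :=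
  (Polynomial.Chebyshev.T (ZMod (2 ^ k)) (n : ℤ)).eval x

/-- The functional graph of a self-map: one arrow `x → f x` for every state `x`. -/
def functionalGraph {V : Type*} (f : V → V) : Digraph V where
  Adj x y := f x = y

/-- The functional graph of the Chebyshev polynomial `T_n` over `ℤ / 2^k`. -/
noncomputable def chebGraph (n k : ℕ) : Digraph (ZMod (2 ^ k)) :=
  functionalGraph (chebMap n k)

/-- The odd states: those whose representative in `{0, …, 2^k - 1}` is odd. -/
def oddStates (k : ℕ) : Set (ZMod (2 ^ k)) :=
  {x | Odd x.val}

/-- `IsCyc G L C`: the vertex set `C` is a component of the digraph `G` and this component is a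
bare directed cycle of length `L ≥ 1`. The vertices of `C` are enumerated injectively by `ℤ / L`,
the only arrow leaving the `i`-th one goes to the `(i+1)`-st, and the only arrow entering it
comes from the `(i-1)`-st; in particular no arrow of `G` joins `C` to its complement.
A cycle of length `1` is a self-loop. -/
def IsCyc {V : Type*} (G : Digraph V) (L : ℕ) (C : Set V) : Prop :=
  0 < L ∧ ∃ c : ZMod L → V, Function.Injective c ∧ Set.range c = C ∧
    (∀ i y, G.Adj (c i) y ↔ y = c (i + 1)) ∧
    (∀ i y, G.Adj y (c i) ↔ y = c (i - 1))

/-- The cycles of length `L` of `G` (as vertex sets) that consist of states in `S`. -/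
def cyclesIn {V : Type*} (G : Digraph V) (S : Set V) (L : ℕ) : Set (Set V) :=
  {C | IsCyc G L C ∧ C ⊆ S}

/-- The part of `G` on the vertex set `S` is a disjoint union of cycles which are components
of `G`, and the multiset of their lengths is `M`. -/
def IsCycleUnion {V : Type*} (G : Digraph V) (S : Set V) (M : Multiset ℕ) : Prop :=
  (∀ x ∈ S, ∃ L, ∃ C ∈ cyclesIn G S L, x ∈ C) ∧
    ∀ L, (cyclesIn G S L).encard = (M.count L : ℕ∞)

/-- `w = max {ν₂(n - 1), ν₂(n + 1)}`, used for odd `n > 1`. -/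
def wExp (n : ℕ) : ℕ :=
  max (padicValNat 2 (n - 1)) (padicValNat 2 (n + 1))

/-- The residues `2^(k-w-t-1) + ε + 2^(k-w-t) j₁ + 2^(k-t) j₂` modulo `2^k`, for
`j₂ = 0, …, 2^t - 1`; here `ε` is `1` or `-1`. -/
def cycResidues (k w t : ℕ) (ε : ℤ) (j₁ : ℕ) : Set (ZMod (2 ^ k)) :=
  {x | ∃ j₂ < 2 ^ t,
    x = (((2 : ℤ) ^ (k - w - t - 1) + ε + 2 ^ (k - w - t) * (j₁ : ℤ) + 2 ^ (k - t) * (j₂ : ℤ) : ℤ) :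
      ZMod (2 ^ k))}

/-- The residues `1 + 2^(k-w-1) j` and `(j+1) 2^(k-w-1) - 1` modulo `2^k`, for
`j = 0, …, 2^(w+1) - 1`. -/
def loopResidues (k w : ℕ) : Set (ZMod (2 ^ k)) :=
  {x | ∃ j < 2 ^ (w + 1),
    x = ((1 + 2 ^ (k - w - 1) * (j : ℤ) : ℤ) : ZMod (2 ^ k)) ∨
    x = ((((j : ℤ) + 1) * 2 ^ (k - w - 1) - 1 : ℤ) : ZMod (2 ^ k))}

end ChebGraph

/-!
For odd `x`, the map `T_n` moves `x` by an amount whose 2-adic valuation is known exactly, and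
everything follows from that.

With `n = 2b + 1`, the identity `cos nθ - cos θ = -2 sin (b+1)θ sin bθ` becomes
`T_n(x) - x = 2 (x² - 1) U_b(x) U_{b-1}(x)` (`T_two_mul_add_one_sub_X`). For odd `x`, the number
`U_{j-1}(x)` has the same 2-adic valuation as `j` (`sameTwoPart_eval_U`): `U_{2j-1} = 2 T_j U_{j-1}`
with `T_j(x)` odd, and `U_{2i}(x)` is odd. Hence `2 (T_n(x) - x)` has the valuation of
`(n² - 1)(x² - 1)`, and `ν₂(n² - 1) = w + 1`.

The iterates of `T_n` are again Chebyshev polynomials, `T_n^[i] = T_{n^i}`, and each squaring of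
`n` raises `ν₂(n² - 1)` by one. So `x` returns after `2^t` steps modulo `2^k` exactly when `2^k`
divides `2^(w+t) (x² - 1)`, which for `x ≡ ε = ±1 mod 4` and `w + t + 1 ≤ k` says that `2^(k-w-t-1)`
divides `x - ε` (`isPeriodicPt_intCast_iff_dvd_sub`). Since `8 ∣ x² - 1`, every odd state is
periodic with period dividing `2^(k-w-3)`, the exponent being truncated at `0`.

Thus the odd states of minimal period `2^t`, `t ≥ 1`, are those with `ν₂(x - ε) = k - w - t - 1`.
Such a state is moved by multiples of `2^(k-t)` only, so its orbit lies in its class modulo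
`2^(k-t)`; that class has `2^t` elements, as many as the orbit, so the two coincide
(`forwardOrbit_eq_cycResidues`). As `T_n` preserves parity and is injective on periodic points, no
further arrow meets these orbits, and they are bare cycles (`cyclesIn_functionalGraph`).
-/

namespace ChebGraph

open Polynomial Polynomial.Chebyshev Function

/-! ### The 2-adic size of `T_N(x) - x` -/

/-- Two integers have the same 2-part when they agree up to odd factors. This encodes
`ν₂(a) = ν₂(b)` in a way that also covers `a = b = 0`. -/
def SameTwoPart (a b : ℤ) : Prop :=
  ∃ c d : ℤ, Odd c ∧ Odd d ∧ a * c = b * d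

theorem SameTwoPart.refl (a : ℤ) : SameTwoPart a a :=
  ⟨1, 1, odd_one, odd_one, rfl⟩

theorem SameTwoPart.of_eq_mul_odd {a b c : ℤ} (h : a = b * c) (hc : Odd c) : SameTwoPart a b :=
  ⟨1, c, odd_one, hc, by rw [mul_one, h]⟩

theorem SameTwoPart.symm {a b : ℤ} : SameTwoPart a b → SameTwoPart b a := by
  rintro ⟨c, d, hc, hd, h⟩
  exact ⟨d, c, hd, hc, h.symm⟩

theorem SameTwoPart.trans {a b c : ℤ} :
    SameTwoPart a b → SameTwoPart b c → SameTwoPart a c := by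
  rintro ⟨p, q, hp, hq, h⟩ ⟨r, s, hr, hs, h'⟩
  exact ⟨p * r, q * s, hp.mul hr, hq.mul hs, by linear_combination r * h + q * h'⟩

theorem SameTwoPart.mul {a b a' b' : ℤ} :
    SameTwoPart a b → SameTwoPart a' b' → SameTwoPart (a * a') (b * b') := by
  rintro ⟨p, q, hp, hq, h⟩ ⟨r, s, hr, hs, h'⟩
  exact ⟨p * r, q * s, hp.mul hr, hq.mul hs, by linear_combination a' * r * h + b * q * h'⟩

theorem SameTwoPart.two_pow_dvd {a b : ℤ} (h : SameTwoPart a b) {m : ℕ} (ha : (2 : ℤ) ^ m ∣ a) :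
    (2 : ℤ) ^ m ∣ b := by
  obtain ⟨c, d, -, hd, h⟩ := h
  have hcop : IsCoprime ((2 : ℤ) ^ m) d := by
    obtain ⟨e, rfl⟩ := hd
    exact IsCoprime.pow_left ⟨-e, 1, by ring⟩
  exact hcop.dvd_of_dvd_mul_right (h ▸ ha.mul_right c)

theorem SameTwoPart.two_pow_dvd_iff {a b : ℤ} (h : SameTwoPart a b) (m : ℕ) :
    (2 : ℤ) ^ m ∣ a ↔ (2 : ℤ) ^ m ∣ b :=
  ⟨h.two_pow_dvd, h.symm.two_pow_dvd⟩

section Chebyshev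

variable {R : Type*} [CommRing R]

theorem two_mul_T_mul_U (m k : ℤ) : 2 * T R m * U R k = U R (k + m) + U R (k - m) := by
  induction m using Polynomial.Chebyshev.induct with
  | zero => simp [two_mul]
  | one => rw [T_one, U_add_one]; ring
  | add_two m ih1 ih2 =>
    have h₁ := U_add_two R (k + m)
    have h₂ := U_sub_two R (k - m)
    have h₃ := T_add_two R m
    linear_combination (norm := ring_nf) 2 * U R k * h₃ - h₂ - h₁ - ih2 + 2 * (X : R[X]) * ih1
  | neg_add_one m ih1 ih2 =>
    have h₁ := U_add_two R (k + (-m - 1))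
    have h₂ := U_sub_two R (k - (-m - 1))
    have h₃ := T_add_two R (-m - 1)
    linear_combination (norm := ring_nf) 2 * U R k * h₃ - h₂ - h₁ - ih2 + 2 * (X : R[X]) * ih1

/-- The double angle formula `sin 2jθ = 2 cos jθ sin jθ`, divided by `sin θ`. -/
theorem U_two_mul_sub_one (j : ℤ) : U R (2 * j - 1) = 2 * T R j * U R (j - 1) := by
  rw [two_mul_T_mul_U, show j - 1 - j = -1 by ring, U_neg_one, add_zero]
  congr 1
  ring

/-- The Pell-type relation between consecutive `U`'s. -/
theorem U_sq_add_U_sq (b : ℕ) :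
    U R b ^ 2 + U R (b - 1 : ℤ) ^ 2 - 2 * X * U R b * U R (b - 1 : ℤ) = 1 := by
  induction b with
  | zero => simp
  | succ b ih =>
    have h := U_add_one R b
    push_cast
    rw [add_sub_cancel_right, h]
    linear_combination ih

/-- The product formula `cos (2b+1)θ - cos θ = -2 sin (b+1)θ sin bθ` in terms of Chebyshev
polynomials. -/
theorem T_two_mul_add_one_sub_X (b : ℕ) :
    T R (2 * b + 1 : ℤ) - X = 2 * (X ^ 2 - 1) * (U R b * U R (b - 1 : ℤ)) := by
  have h₁ := T_mul_T R (b + 1 : ℤ) b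
  rw [show (b + 1 + b : ℤ) = 2 * b + 1 by ring, show (b + 1 - b : ℤ) = 1 by ring, T_one] at h₁
  have h₂ := T_eq_U_sub_X_mul_U R (b : ℤ)
  have h₃ : T R (b + 1 : ℤ) = X * U R (b : ℤ) - U R (b - 1 : ℤ) := by
    have := T_eq_X_mul_U_sub_U R (b - 1 : ℤ)
    rwa [show (b - 1 + 2 : ℤ) = b + 1 by ring, sub_add_cancel] at this
  rw [h₂, h₃] at h₁
  linear_combination -h₁ + 2 * X * U_sq_add_U_sq (R := R) b

end Chebyshev

theorem odd_eval_T {x : ℤ} (hx : Odd x) (m : ℤ) : Odd ((T ℤ m).eval x) := by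
  obtain ⟨y, rfl⟩ := hx
  obtain ⟨z, hz⟩ := (Dvd.intro y (by ring) : (2 : ℤ) ∣ (2 * y + 1) - 1).trans
    (sub_dvd_eval_sub (2 * y + 1) 1 (T ℤ m))
  rw [T_eval_one] at hz
  exact ⟨z, by linarith⟩

theorem even_eval_T {x m : ℤ} (hx : Even x) (hm : Odd m) : Even ((T ℤ m).eval x) := by
  have h := (by simpa using hx.two_dvd : (2 : ℤ) ∣ x - 0).trans (sub_dvd_eval_sub x 0 (T ℤ m))
  rw [T_eval_zero_of_odd ℤ hm, sub_zero] at h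
  exact even_iff_two_dvd.2 h

theorem odd_eval_U_two_mul {x : ℤ} (hx : Odd x) (i : ℕ) : Odd ((U ℤ (2 * i : ℤ)).eval x) := by
  obtain ⟨y, rfl⟩ := hx
  obtain ⟨z, hz⟩ := (Dvd.intro y (by ring) : (2 : ℤ) ∣ (2 * y + 1) - 1).trans
    (sub_dvd_eval_sub (2 * y + 1) 1 (U ℤ (2 * i : ℤ)))
  rw [U_eval_one] at hz
  exact ⟨z + i, by push_cast at hz; linarith⟩

/-- At an odd integer, `U_{j-1}` has the same 2-adic valuation as `j`. Doubling `j` multiplies both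
sides by 2 up to an odd factor, and for odd `j` both are odd. -/
theorem sameTwoPart_eval_U {x : ℤ} (hx : Odd x) (j : ℕ) :
    SameTwoPart ((U ℤ (j - 1 : ℤ)).eval x) j := by
  induction j using Nat.strong_induction_on with
  | _ j ih =>
    obtain ⟨i, rfl | rfl⟩ := Nat.even_or_odd' j
    · rcases Nat.eq_zero_or_pos i with rfl | hi
      · simpa using SameTwoPart.refl 0
      · push_cast
        rw [U_two_mul_sub_one]
        have h := ((SameTwoPart.refl 2).mul (ih i (by omega)))
        refine SameTwoPart.trans (.of_eq_mul_odd ?_ (odd_eval_T hx i)) h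
        simp only [eval_mul, eval_ofNat]
        ring
    · push_cast
      rw [add_sub_cancel_right]
      exact ⟨2 * i + 1, _, odd_two_mul_add_one _, odd_eval_U_two_mul hx i, mul_comm _ _⟩

theorem sameTwoPart_two_mul_eval_T_sub {x : ℤ} (hx : Odd x) {N : ℕ} (hN : Odd N) :
    SameTwoPart (2 * ((T ℤ N).eval x - x)) (((N : ℤ) ^ 2 - 1) * (x ^ 2 - 1)) := by
  obtain ⟨b, rfl⟩ := hN
  have h := congrArg (Polynomial.eval x) (T_two_mul_add_one_sub_X (R := ℤ) b)
  simp only [eval_sub, eval_mul, eval_pow, eval_X, eval_ofNat, eval_one] at h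
  have hb := sameTwoPart_eval_U hx (b + 1)
  push_cast at hb ⊢
  rw [add_sub_cancel_right] at hb
  rw [h]
  have := (SameTwoPart.refl (4 * (x ^ 2 - 1))).mul (hb.mul (sameTwoPart_eval_U hx b))
  convert this using 1 <;> ring

/-! ### The exponent `w` -/

theorem sameTwoPart_two_pow_padicValNat {m : ℕ} (hm : m ≠ 0) :
    SameTwoPart m (2 ^ padicValNat 2 m) := by
  obtain ⟨c, hc⟩ := pow_padicValNat_dvd (p := 2) (n := m)
  have hodd : Odd c := by
    rw [← Nat.not_even_iff_odd]
    rintro ⟨d, rfl⟩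
    exact pow_succ_padicValNat_not_dvd (p := 2) hm ⟨d, by rw [pow_succ]; linarith⟩
  exact .of_eq_mul_odd (c := c) (by exact_mod_cast hc) (by exact_mod_cast hodd)

/-- One of `n - 1`, `n + 1` is twice an odd number, so `w` is the valuation of `n² - 1` less one. -/
theorem sameTwoPart_sq_sub_one {n : ℕ} (hn : 1 < n) (hodd : Odd n) :
    SameTwoPart ((n : ℤ) ^ 2 - 1) (2 ^ (wExp n + 1)) := by
  have h₁ := sameTwoPart_two_pow_padicValNat (show n - 1 ≠ 0 by omega)
  have h₂ := sameTwoPart_two_pow_padicValNat (show n + 1 ≠ 0 by omega)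
  have h := h₁.mul h₂
  have key : padicValNat 2 (n - 1) + padicValNat 2 (n + 1) = wExp n + 1 := by
    have hval : ∀ m : ℕ, m % 4 = 2 → padicValNat 2 m = 1 := by
      intro m hm
      have a := (padicValNat_dvd_iff_le (p := 2) (a := m) (n := 1) (by omega)).1 (by omega)
      have b := mt (padicValNat_dvd_iff_le (p := 2) (a := m) (n := 2) (by omega)).2 (by omega)
      omega
    have hpos : ∀ m : ℕ, m ≠ 0 → m % 2 = 0 → 1 ≤ padicValNat 2 m := by
      intro m hm hm'
      exact (padicValNat_dvd_iff_le (p := 2) (n := 1) hm).1 (by omega)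
    have p₁ := hpos (n - 1) (by omega) (by obtain ⟨b, rfl⟩ := hodd; omega)
    have p₂ := hpos (n + 1) (by omega) (by obtain ⟨b, rfl⟩ := hodd; omega)
    unfold wExp
    rcases (show (n - 1) % 4 = 2 ∨ (n + 1) % 4 = 2 by
      obtain ⟨b, rfl⟩ := hodd; omega) with h | h
    · have := hval _ h
      omega
    · have := hval _ h
      omega
  rw [← pow_add, key] at h
  convert h using 1
  push_cast [show 1 ≤ n by omega]
  ring

theorem sameTwoPart_two_pow_pow_sub_one {n : ℕ} (hn : 1 < n) (hodd : Odd n) (t : ℕ) :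
    SameTwoPart (((n ^ 2 ^ t : ℕ) : ℤ) ^ 2 - 1) (2 ^ (wExp n + 1 + t)) := by
  induction t with
  | zero => simpa using sameTwoPart_sq_sub_one hn hodd
  | succ t ih =>
    have hN : Odd (((n ^ 2 ^ t : ℕ) : ℤ)) := by exact_mod_cast hodd.pow
    rw [pow_succ 2 t, pow_mul, Nat.cast_pow (n ^ 2 ^ t), ← add_assoc, pow_succ 2 (wExp n + 1 + t)]
    generalize ((n ^ 2 ^ t : ℕ) : ℤ) = N at *
    have h2 : SameTwoPart (N ^ 2 + 1) 2 := by
      obtain ⟨b, rfl⟩ := hN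
      exact .of_eq_mul_odd (c := 2 * (b ^ 2 + b) + 1) (by ring) (odd_two_mul_add_one _)
    convert ih.mul h2 using 1
    ring

theorem sameTwoPart_sq_sub_one_of_four_dvd {x ε : ℤ} (hε : ε = 1 ∨ ε = -1) (h : 4 ∣ x - ε) :
    SameTwoPart (x ^ 2 - 1) (2 * (x - ε)) := by
  obtain ⟨y, hy⟩ := h
  obtain rfl : x = 4 * y + ε := by linarith
  refine .of_eq_mul_odd (c := 2 * y + ε) ?_ ?_
  · rcases hε with rfl | rfl <;> ring
  · rcases hε with rfl | rfl
    · exact odd_two_mul_add_one y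
    · exact ⟨y - 1, by ring⟩

/-! ### Dynamics of `T_n` on the odd states -/

theorem chebMap_intCast (n k : ℕ) (x : ℤ) :
    chebMap n k (x : ZMod (2 ^ k)) = (((T ℤ n).eval x : ℤ) : ZMod (2 ^ k)) := by
  simpa [chebMap] using (algebraMap_eval_T (R := ℤ) (R' := ZMod (2 ^ k)) x n).symm

theorem chebMap_iterate (n k i : ℕ) : (chebMap n k)^[i] = chebMap (n ^ i) k := by
  induction i with
  | zero => ext x; simp [chebMap]
  | succ i ih =>
    ext x
    rw [iterate_succ_apply', ih]
    simp only [chebMap]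
    rw [← eval_comp, ← T_mul, pow_succ']
    push_cast
    rfl

theorem isPeriodicPt_intCast_iff {n k : ℕ} (hn : 1 < n) (hodd : Odd n) {x : ℤ} (hx : Odd x)
    (t : ℕ) :
    IsPeriodicPt (chebMap n k) (2 ^ t) (x : ZMod (2 ^ k)) ↔
      (2 : ℤ) ^ k ∣ 2 ^ (wExp n + t) * (x ^ 2 - 1) := by
  rw [IsPeriodicPt, IsFixedPt, chebMap_iterate, chebMap_intCast, eq_comm,
    ZMod.intCast_eq_intCast_iff_dvd_sub]
  have h := (sameTwoPart_two_mul_eval_T_sub hx (hodd.pow (n := 2 ^ t))).trans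
    ((sameTwoPart_two_pow_pow_sub_one hn hodd t).mul (.refl (x ^ 2 - 1)))
  have h' := h.two_pow_dvd_iff (k + 1)
  rw [show wExp n + 1 + t = (wExp n + t) + 1 by ring, pow_succ' _ k, pow_succ' _ (wExp n + t),
    mul_assoc, mul_dvd_mul_iff_left two_ne_zero, mul_dvd_mul_iff_left two_ne_zero] at h'
  simpa using h'

/-- The period of `x ≡ ε mod 4` is governed by the 2-adic distance of `x` to `ε = ±1`. -/
theorem isPeriodicPt_intCast_iff_dvd_sub {n k : ℕ} (hn : 1 < n) (hodd : Odd n) {x ε : ℤ}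
    (hε : ε = 1 ∨ ε = -1) (h4 : 4 ∣ x - ε) {t : ℕ} (ht : wExp n + t + 1 ≤ k) :
    IsPeriodicPt (chebMap n k) (2 ^ t) (x : ZMod (2 ^ k)) ↔
      (2 : ℤ) ^ (k - wExp n - t - 1) ∣ x - ε := by
  have hx : Odd x := by
    rw [Int.odd_iff]
    omega
  have h := (SameTwoPart.refl (2 ^ (wExp n + t))).mul (sameTwoPart_sq_sub_one_of_four_dvd hε h4)
  rw [isPeriodicPt_intCast_iff hn hodd hx, h.two_pow_dvd_iff, ← mul_assoc, ← pow_succ]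
  nth_rw 1 [show k = (wExp n + t + 1) + (k - wExp n - t - 1) by omega]
  rw [pow_add, mul_dvd_mul_iff_left (by positivity)]

theorem exists_sign_four_dvd_sub {x : ℤ} (hx : Odd x) :
    ∃ ε : ℤ, (ε = 1 ∨ ε = -1) ∧ 4 ∣ x - ε := by
  rw [Int.odd_iff] at hx
  rcases (show 4 ∣ x - 1 ∨ 4 ∣ x - (-1) by omega) with h | h
  · exact ⟨1, .inl rfl, h⟩
  · exact ⟨-1, .inr rfl, h⟩

theorem intCast_mem_oddStates {k : ℕ} (hk : 1 ≤ k) {x : ℤ} :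
    (x : ZMod (2 ^ k)) ∈ oddStates k ↔ Odd x := by
  have h := ZMod.val_intCast (n := 2 ^ k) x
  obtain ⟨l, rfl⟩ : ∃ l, k = l + 1 := ⟨k - 1, by omega⟩
  rw [oddStates, Set.mem_ofPred_eq, ← Int.odd_coe_nat, h, Int.odd_iff, Int.odd_iff]
  push_cast
  rw [Int.emod_emod_of_dvd _ (dvd_pow_self 2 (by omega))]

theorem chebMap_mem_oddStates_iff {n k : ℕ} (hodd : Odd n) (hk : 1 ≤ k) (x : ZMod (2 ^ k)) :
    chebMap n k x ∈ oddStates k ↔ x ∈ oddStates k := by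
  obtain ⟨x, rfl⟩ := ZMod.intCast_surjective x
  rw [chebMap_intCast, intCast_mem_oddStates hk, intCast_mem_oddStates hk]
  refine ⟨fun h => ?_, fun h => odd_eval_T h n⟩
  by_contra hx
  exact Int.not_odd_iff_even.2
    (even_eval_T (Int.not_odd_iff_even.1 hx) (by exact_mod_cast hodd)) h

/-- Every odd state returns after `2^(k-w-3)` steps; when `k < w + 3` the truncated exponent is
`0` and the state is fixed. -/
theorem isPeriodicPt_of_mem_oddStates {n k : ℕ} (hn : 1 < n) (hodd : Odd n) (hk : 1 ≤ k)
    {x : ZMod (2 ^ k)} (hx : x ∈ oddStates k) :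
    IsPeriodicPt (chebMap n k) (2 ^ (k - wExp n - 3)) x := by
  obtain ⟨x, rfl⟩ := ZMod.intCast_surjective x
  rw [intCast_mem_oddStates hk] at hx
  rw [isPeriodicPt_intCast_iff hn hodd hx]
  obtain ⟨c, hc⟩ := Int.eight_dvd_sq_sub_one_of_odd hx
  have : (2 : ℤ) ^ k ∣ 2 ^ (wExp n + (k - wExp n - 3) + 3) := pow_dvd_pow _ (by omega)
  refine this.trans ⟨c, ?_⟩
  rw [hc, pow_add]
  ring

/-! ### Bare cycles of functional graphs -/

section FunctionalGraph

variable {V : Type*} {f : V → V} {S : Set V} {x : V}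

/-- The forward orbit of `x` under `f`. -/
def forwardOrbit (f : V → V) (x : V) : Set V :=
  Set.range fun i : ℕ => f^[i] x

theorem forwardOrbit_subset (hS : ∀ y, f y ∈ S ↔ y ∈ S) (hx : x ∈ S) : forwardOrbit f x ⊆ S := by
  rintro _ ⟨i, rfl⟩
  induction i with
  | zero => exact hx
  | succ i ih =>
    simp only [iterate_succ_apply']
    exact (hS _).2 ih

theorem self_mem_forwardOrbit (f : V → V) (x : V) : x ∈ forwardOrbit f x :=
  ⟨0, rfl⟩

theorem forwardOrbit_eq_singleton (h : IsFixedPt f x) : forwardOrbit f x = {x} := by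
  ext y
  simp only [forwardOrbit, Set.mem_range, Set.mem_singleton_iff, iterate_fixed h, exists_const,
    eq_comm]

/-- The orbit of a point of minimal period `L` is enumerated by `ℤ / L`; injectivity of `f` on
periodic points ensures that no other arrow enters it. -/
theorem isCyc_forwardOrbit (hS : ∀ y, f y ∈ S ↔ y ∈ S) (hper : ∀ y ∈ S, y ∈ periodicPts f)
    (hx : x ∈ S) : IsCyc (functionalGraph f) (minimalPeriod f x) (forwardOrbit f x) := by
  have hpos := minimalPeriod_pos_of_mem_periodicPts (hper x hx)
  have : NeZero (minimalPeriod f x) := ⟨hpos.ne'⟩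
  have hstep : ∀ i : ZMod (minimalPeriod f x), f (f^[i.val] x) = f^[(i + 1).val] x := by
    intro i
    rw [ZMod.val_add, ZMod.val_one_eq_one_mod, Nat.add_mod_mod, iterate_mod_minimalPeriod_eq,
      iterate_succ_apply']
  have hmem : ∀ i : ℕ, f^[i] x ∈ S := fun i => forwardOrbit_subset hS hx ⟨i, rfl⟩
  refine ⟨hpos, fun i => f^[i.val] x, ?_, ?_, ?_, ?_⟩
  · intro i j hij
    exact ZMod.val_injective _ (iterate_injOn_Iio_minimalPeriod (ZMod.val_lt i) (ZMod.val_lt j) hij)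
  · ext y
    constructor
    · rintro ⟨i, rfl⟩
      exact ⟨i.val, rfl⟩
    · rintro ⟨i, rfl⟩
      refine ⟨(i : ZMod (minimalPeriod f x)), ?_⟩
      simp only [ZMod.val_natCast, iterate_mod_minimalPeriod_eq]
  · intro i y
    change f (f^[i.val] x) = y ↔ _
    rw [hstep, eq_comm]
  · intro i y
    change f y = f^[i.val] x ↔ _
    have hi : f (f^[(i - 1).val] x) = f^[i.val] x := by rw [hstep, sub_add_cancel]
    refine ⟨fun h => ?_, fun h => h ▸ hi⟩
    -- `y` lies in `S` because its image does, and `f` is injective on periodic points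
    have hy : y ∈ S := (hS y).1 (h ▸ hmem _)
    exact (bijOn_periodicPts f).injOn (hper y hy) (hper _ (hmem _)) (h.trans hi.symm)

theorem IsCyc.exists_forwardOrbit {L : ℕ} {C : Set V} (h : IsCyc (functionalGraph f) L C) :
    ∃ x ∈ C, minimalPeriod f x = L ∧ C = forwardOrbit f x := by
  obtain ⟨hL, c, hinj, rfl, hout, -⟩ := h
  have : NeZero L := ⟨hL.ne'⟩
  have hstep : ∀ i, f (c i) = c (i + 1) := fun i => (hout i _).2 rfl
  have hiter : ∀ j : ℕ, f^[j] (c 0) = c j := by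
    intro j
    induction j with
    | zero => simp
    | succ j ih => rw [iterate_succ_apply', ih, hstep, Nat.cast_succ]
  have hperiod : ∀ j : ℕ, IsPeriodicPt f j (c 0) ↔ L ∣ j := fun j => by
    rw [IsPeriodicPt, IsFixedPt, hiter, hinj.eq_iff, ZMod.natCast_eq_zero_iff]
  refine ⟨c 0, ⟨0, rfl⟩, Nat.dvd_antisymm ?_ ?_, ?_⟩
  · exact ((hperiod L).2 dvd_rfl).minimalPeriod_dvd
  · exact (hperiod _).1 (isPeriodicPt_minimalPeriod f _)
  · ext y
    constructor
    · rintro ⟨i, rfl⟩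
      exact ⟨i.val, by simp [hiter]⟩
    · rintro ⟨i, rfl⟩
      exact ⟨i, (hiter i).symm⟩

/-- If `S` is a union of components consisting of periodic points, then the cycles of length `L`
in `S` are the orbits of the points of `S` with minimal period `L`. -/
theorem cyclesIn_functionalGraph (hS : ∀ y, f y ∈ S ↔ y ∈ S) (hper : ∀ y ∈ S, y ∈ periodicPts f)
    (L : ℕ) :
    cyclesIn (functionalGraph f) S L =
      {C | ∃ x ∈ S, minimalPeriod f x = L ∧ C = forwardOrbit f x} := by
  ext C
  constructor
  · rintro ⟨hC, hCS⟩
    obtain ⟨x, hx, h⟩ := hC.exists_forwardOrbit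
    exact ⟨x, hCS hx, h⟩
  · rintro ⟨x, hx, rfl, rfl⟩
    exact ⟨isCyc_forwardOrbit hS hper hx, forwardOrbit_subset hS hx⟩

theorem cyclesIn_functionalGraph_one (hS : ∀ y, f y ∈ S ↔ y ∈ S)
    (hper : ∀ y ∈ S, y ∈ periodicPts f) :
    cyclesIn (functionalGraph f) S 1 = {C | ∃ x ∈ S, IsFixedPt f x ∧ C = {x}} := by
  rw [cyclesIn_functionalGraph hS hper]
  ext C
  refine exists_congr fun x => and_congr_right fun _ => ?_
  rw [minimalPeriod_eq_one_iff_isFixedPt]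
  exact and_congr_right fun h => by rw [forwardOrbit_eq_singleton h]

theorem exists_mem_cyclesIn (hS : ∀ y, f y ∈ S ↔ y ∈ S) (hper : ∀ y ∈ S, y ∈ periodicPts f)
    (hx : x ∈ S) : ∃ L, ∃ C ∈ cyclesIn (functionalGraph f) S L, x ∈ C :=
  ⟨_, _, ⟨isCyc_forwardOrbit hS hper hx, forwardOrbit_subset hS hx⟩, self_mem_forwardOrbit f x⟩

theorem ncard_forwardOrbit (hx : x ∈ periodicPts f) :
    (forwardOrbit f x).ncard = minimalPeriod f x := by
  have hpos := minimalPeriod_pos_of_mem_periodicPts hx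
  have : forwardOrbit f x = (fun i => f^[i] x) '' Set.Iio (minimalPeriod f x) := by
    ext y
    constructor
    · rintro ⟨i, rfl⟩
      exact ⟨i % minimalPeriod f x, Nat.mod_lt _ hpos, iterate_mod_minimalPeriod_eq⟩
    · rintro ⟨i, -, rfl⟩
      exact ⟨i, rfl⟩
  rw [this, iterate_injOn_Iio_minimalPeriod.ncard_image]
  simp [Set.ncard_eq_toFinset_card']

end FunctionalGraph

/-! ### Orbits of length `2^t` -/

theorem mem_oddStates_of_mem_cycResidues {k w t : ℕ} {ε : ℤ} (hε : ε = 1 ∨ ε = -1) {j : ℕ}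
    (ht : t + w + 3 ≤ k) {x : ZMod (2 ^ k)} (hx : x ∈ cycResidues k w t ε j) :
    x ∈ oddStates k := by
  obtain ⟨i, -, rfl⟩ := hx
  rw [intCast_mem_oddStates (by omega), show k - w - t - 1 = (k - w - t - 2) + 1 by omega,
    show k - w - t = (k - w - t - 1) + 1 by omega, show k - t = (k - t - 1) + 1 by omega,
    pow_succ, pow_succ, pow_succ]
  rcases hε with rfl | rfl <;> grind

/-- A residue `2^(k-t) i` modulo `2^k` depends on `i` modulo `2^t` only. -/
theorem exists_lt_two_pow_mul_eq {k t : ℕ} (ht : t ≤ k) (i : ℤ) :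
    ∃ j : ℕ, j < 2 ^ t ∧
      ((2 ^ (k - t) * i : ℤ) : ZMod (2 ^ k)) = ((2 ^ (k - t) * j : ℤ) : ZMod (2 ^ k)) := by
  have hlt : i % 2 ^ t < 2 ^ t := Int.emod_lt_of_pos _ (by positivity)
  obtain ⟨j, hj⟩ := Int.eq_ofNat_of_zero_le (Int.emod_nonneg i (b := 2 ^ t) (by positivity))
  refine ⟨j, by rw [hj] at hlt; exact_mod_cast hlt, ?_⟩
  rw [eq_comm, ZMod.intCast_eq_intCast_iff_dvd_sub]
  have hpow : (2 : ℤ) ^ k = 2 ^ (k - t) * 2 ^ t := by rw [← pow_add]; congr 1; omega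
  push_cast
  refine ⟨i / 2 ^ t, ?_⟩
  have := Int.mul_ediv_add_emod i (2 ^ t)
  rw [hpow, ← hj]
  linear_combination -2 ^ (k - t) * this

/-- The set `cycResidues k w t ε j` is a residue class modulo `2^(k-t)`. Its index `j₂` ranges over
all integers below `2^t`, but by `exists_lt_two_pow_mul_eq` negative ones give no new residues. -/
theorem mem_cycResidues_iff {k w t : ℕ} (ht : t + w + 1 ≤ k) {ε : ℤ} {j : ℕ} {x : ℤ} :
    (x : ZMod (2 ^ k)) ∈ cycResidues k w t ε j ↔
      (2 : ℤ) ^ (k - t) ∣ x - (2 ^ (k - w - t - 1) + ε + 2 ^ (k - w - t) * j) := by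
  constructor
  · rintro ⟨i, -, hi⟩
    rw [eq_comm, ZMod.intCast_eq_intCast_iff_dvd_sub] at hi
    push_cast at hi
    have h := (pow_dvd_pow 2 (Nat.sub_le k t)).trans hi
    rw [← sub_sub] at h
    exact (dvd_sub_left (dvd_mul_right _ _)).1 h
  · rintro ⟨q, hq⟩
    obtain ⟨i, hi, hqi⟩ := exists_lt_two_pow_mul_eq (show t ≤ k by omega) q
    refine ⟨i, by exact_mod_cast hi, ?_⟩
    rw [Int.cast_add _ (2 ^ (k - t) * (i : ℤ)), ← hqi, ← Int.cast_add, ← hq]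
    congr 1
    ring

theorem ncard_cycResidues_le {k t : ℕ} (ht : t ≤ k) (w : ℕ) (ε : ℤ) (j : ℕ) :
    (cycResidues k w t ε j).ncard ≤ 2 ^ t := by
  have hsub : cycResidues k w t ε j ⊆ (fun i : ℕ => (((2 : ℤ) ^ (k - w - t - 1) + ε +
      2 ^ (k - w - t) * (j : ℤ) + 2 ^ (k - t) * (i : ℤ) : ℤ) : ZMod (2 ^ k))) ''
      (Finset.range (2 ^ t) : Set ℕ) := by
    rintro _ ⟨i, -, rfl⟩
    obtain ⟨i', hi', h⟩ := exists_lt_two_pow_mul_eq ht i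
    refine ⟨i', by simpa using hi', ?_⟩
    simp only
    rw [Int.cast_add, ← h, ← Int.cast_add]
  refine (Set.ncard_le_ncard hsub (Set.toFinite _)).trans
    ((Set.ncard_image_le (Finset.finite_toSet _)).trans ?_)
  rw [Set.ncard_coe_finset, Finset.card_range]

theorem cycResidues_nonempty (k w t : ℕ) (ε : ℤ) (j : ℕ) : (cycResidues k w t ε j).Nonempty :=
  ⟨_, 0, by positivity, rfl⟩

section

variable {n k : ℕ}

/-- A state has period dividing `2^t` only if `T_n` moves it by a multiple of `2^(k-t)`, so its
whole orbit stays in one residue class modulo `2^(k-t)`. -/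
theorem forwardOrbit_subset_cycResidues (hn : 1 < n) (hodd : Odd n) {t : ℕ} {ε : ℤ}
    (hε : ε = 1 ∨ ε = -1) {j : ℕ} (ht : t + wExp n + 3 ≤ k) {x : ZMod (2 ^ k)}
    (hx : x ∈ cycResidues k (wExp n) t ε j) (hper : IsPeriodicPt (chebMap n k) (2 ^ t) x) :
    forwardOrbit (chebMap n k) x ⊆ cycResidues k (wExp n) t ε j := by
  have hxo := mem_oddStates_of_mem_cycResidues hε ht hx
  obtain ⟨x, rfl⟩ := ZMod.intCast_surjective x
  rw [intCast_mem_oddStates (by omega)] at hxo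
  set T := Polynomial.Chebyshev.T ℤ n
  have hmove : (2 : ℤ) ^ (k - t) ∣ T.eval x - x := by
    -- a fixed point modulo `2^(k-t)`, by the same criterion with `k - t` in place of `k`
    have h := (isPeriodicPt_intCast_iff hn hodd hxo t).1 hper
    have h₀ : IsPeriodicPt (chebMap n (k - t)) (2 ^ 0) (x : ZMod (2 ^ (k - t))) := by
      rw [isPeriodicPt_intCast_iff hn hodd hxo, add_zero]
      rw [show k = t + (k - t) by omega, add_comm (wExp n), pow_add, pow_add, mul_assoc,
        mul_dvd_mul_iff_left (by positivity)] at h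
      simpa using h
    rw [pow_zero, IsPeriodicPt, iterate_one, IsFixedPt, chebMap_intCast, eq_comm,
      ZMod.intCast_eq_intCast_iff_dvd_sub] at h₀
    simpa using h₀
  have hiter : ∀ i : ℕ, ∃ y : ℤ, (y : ZMod (2 ^ k)) = (chebMap n k)^[i] x ∧
      (2 : ℤ) ^ (k - t) ∣ y - x := by
    intro i
    induction i with
    | zero => exact ⟨x, rfl, by simp⟩
    | succ i ih =>
      obtain ⟨y, hy, hyx⟩ := ih
      refine ⟨T.eval y, by rw [iterate_succ_apply', ← hy, chebMap_intCast], ?_⟩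
      have := dvd_add (hyx.trans (Polynomial.sub_dvd_eval_sub y x T)) hmove
      simpa using this
  rintro _ ⟨i, rfl⟩
  obtain ⟨y, hy, hyx⟩ := hiter i
  simp only [← hy]
  rw [mem_cycResidues_iff (by omega)] at hx ⊢
  simpa using dvd_add hyx hx

theorem minimalPeriod_of_mem_cycResidues (hn : 1 < n) (hodd : Odd n) {t : ℕ} {ε : ℤ}
    (hε : ε = 1 ∨ ε = -1) {j : ℕ} (ht₁ : 1 ≤ t) (ht : t + wExp n + 3 ≤ k) {x : ZMod (2 ^ k)}
    (hx : x ∈ cycResidues k (wExp n) t ε j) : minimalPeriod (chebMap n k) x = 2 ^ t := by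
  obtain ⟨s, rfl⟩ : ∃ s, t = s + 1 := ⟨t - 1, by omega⟩
  obtain ⟨i, -, rfl⟩ := hx
  -- `x = ε + 2^m * odd` with `m = k - w - t - 1 ≥ 2`
  obtain ⟨m, hm⟩ : ∃ m, k = m + 2 + wExp n + (s + 1) + 1 :=
    ⟨k - wExp n - (s + 1) - 3, by omega⟩
  set w := wExp n with hw
  rw [show k - w - (s + 1) - 1 = m + 2 by omega, show k - w - (s + 1) = m + 2 + 1 by omega,
    show k - (s + 1) = m + 2 + 1 + w by omega]
  set x : ℤ := 2 ^ (m + 2) + ε + 2 ^ (m + 2 + 1) * j + 2 ^ (m + 2 + 1 + w) * i with hx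
  have hxε : x - ε = 2 ^ (m + 2) * (2 * (j + 2 ^ w * i) + 1) := by rw [hx]; ring
  have h4 : 4 ∣ x - ε := ⟨2 ^ m * (2 * (j + 2 ^ w * i) + 1), by rw [hxε]; ring⟩
  have : Fact (Nat.Prime 2) := ⟨Nat.prime_two⟩
  apply minimalPeriod_eq_prime_pow
  · rw [isPeriodicPt_intCast_iff_dvd_sub hn hodd hε h4 (by omega), hxε,
      show k - wExp n - s - 1 = m + 2 + 1 by omega, pow_succ _ (m + 2),
      mul_dvd_mul_iff_left (by positivity)]
    omega
  · rw [isPeriodicPt_intCast_iff_dvd_sub hn hodd hε h4 (by omega), hxε,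
      show k - wExp n - (s + 1) - 1 = m + 2 by omega]
    exact dvd_mul_right _ _

theorem exists_mem_cycResidues_of_minimalPeriod (hn : 1 < n) (hodd : Odd n) {t : ℕ}
    (ht₁ : 1 ≤ t) (ht : t + wExp n + 3 ≤ k) {x : ZMod (2 ^ k)} (hx : x ∈ oddStates k)
    (hper : minimalPeriod (chebMap n k) x = 2 ^ t) :
    ∃ ε : ℤ, (ε = 1 ∨ ε = -1) ∧ ∃ j < 2 ^ wExp n, x ∈ cycResidues k (wExp n) t ε j := by
  obtain ⟨s, rfl⟩ : ∃ s, t = s + 1 := ⟨t - 1, by omega⟩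
  obtain ⟨x, rfl⟩ := ZMod.intCast_surjective x
  rw [intCast_mem_oddStates (by omega)] at hx
  obtain ⟨ε, hε, h4⟩ := exists_sign_four_dvd_sub hx
  obtain ⟨m, hm⟩ : ∃ m, k = m + wExp n + (s + 1) + 1 := ⟨k - wExp n - (s + 1) - 1, by omega⟩
  have h₁ := (isPeriodicPt_intCast_iff_dvd_sub hn hodd hε h4 (by omega)).1
    (isPeriodicPt_iff_minimalPeriod_dvd.2 hper.dvd)
  have h₂ := mt (isPeriodicPt_intCast_iff_dvd_sub hn hodd hε h4
    (show wExp n + s + 1 ≤ k by omega)).2 (fun h => by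
      have := Nat.le_of_dvd (by positivity) (hper ▸ h.minimalPeriod_dvd)
      exact absurd this (not_le.2 (Nat.pow_lt_pow_right one_lt_two (Nat.lt_succ_self s))))
  rw [show k - wExp n - (s + 1) - 1 = m by omega] at h₁
  rw [show k - wExp n - s - 1 = m + 1 by omega] at h₂
  obtain ⟨q, hq⟩ := h₁
  rw [hq, pow_succ, mul_dvd_mul_iff_left (by positivity), ← even_iff_two_dvd,
    Int.not_even_iff_odd] at h₂
  obtain ⟨r, rfl⟩ := h₂
  have hnn : 0 ≤ r % 2 ^ wExp n := Int.emod_nonneg _ (by positivity)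
  have hlt : r % 2 ^ wExp n < 2 ^ wExp n := Int.emod_lt_of_pos _ (by positivity)
  obtain ⟨j, hj⟩ := Int.eq_ofNat_of_zero_le hnn
  refine ⟨ε, hε, j, by rw [hj] at hlt; exact_mod_cast hlt, ?_⟩
  rw [mem_cycResidues_iff (by omega), show k - wExp n - (s + 1) - 1 = m by omega,
    show k - wExp n - (s + 1) = m + 1 by omega, show k - (s + 1) = m + 1 + wExp n by omega]
  refine ⟨r / 2 ^ wExp n, ?_⟩
  have := Int.mul_ediv_add_emod r (2 ^ wExp n)
  rw [← hj, pow_add, pow_succ]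
  linear_combination hq - 2 ^ (m + 1) * this

theorem forwardOrbit_eq_cycResidues (hn : 1 < n) (hodd : Odd n) {t : ℕ} {ε : ℤ}
    (hε : ε = 1 ∨ ε = -1) {j : ℕ} (ht₁ : 1 ≤ t) (ht : t + wExp n + 3 ≤ k) {x : ZMod (2 ^ k)}
    (hx : x ∈ cycResidues k (wExp n) t ε j) :
    forwardOrbit (chebMap n k) x = cycResidues k (wExp n) t ε j := by
  have hmin := minimalPeriod_of_mem_cycResidues hn hodd hε ht₁ ht hx
  have hper : IsPeriodicPt (chebMap n k) (2 ^ t) x := hmin ▸ isPeriodicPt_minimalPeriod _ x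
  refine Set.eq_of_subset_of_ncard_le
    (forwardOrbit_subset_cycResidues hn hodd hε ht hx hper) ?_ (Set.toFinite _)
  rw [ncard_forwardOrbit (mk_mem_periodicPts (by positivity) hper), hmin]
  exact ncard_cycResidues_le (by omega) ..

theorem mem_periodicPts_of_mem_oddStates (hn : 1 < n) (hodd : Odd n) (hk : 1 ≤ k) :
    ∀ x ∈ oddStates k, x ∈ periodicPts (chebMap n k) := fun _ hx =>
  mk_mem_periodicPts (by positivity) (isPeriodicPt_of_mem_oddStates hn hodd hk hx)

theorem cyclesIn_two_pow (hn : 1 < n) (hodd : Odd n) {t : ℕ} (ht₁ : 1 ≤ t)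
    (ht : t + wExp n + 3 ≤ k) :
    cyclesIn (chebGraph n k) (oddStates k) (2 ^ t) =
      {C | ∃ ε : ℤ, (ε = 1 ∨ ε = -1) ∧ ∃ j₁ < 2 ^ wExp n, C = cycResidues k (wExp n) t ε j₁} := by
  rw [chebGraph, cyclesIn_functionalGraph (chebMap_mem_oddStates_iff hodd (by omega))
    (mem_periodicPts_of_mem_oddStates hn hodd (by omega))]
  ext C
  constructor
  · rintro ⟨x, hx, hper, rfl⟩
    obtain ⟨ε, hε, j, hj, hmem⟩ := exists_mem_cycResidues_of_minimalPeriod hn hodd ht₁ ht hx hper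
    exact ⟨ε, hε, j, hj, forwardOrbit_eq_cycResidues hn hodd hε ht₁ ht hmem⟩
  · rintro ⟨ε, hε, j, hj, rfl⟩
    obtain ⟨x, hx⟩ := cycResidues_nonempty k (wExp n) t ε j
    exact ⟨x, mem_oddStates_of_mem_cycResidues hε ht hx,
      minimalPeriod_of_mem_cycResidues hn hodd hε ht₁ ht hx,
      (forwardOrbit_eq_cycResidues hn hodd hε ht₁ ht hx).symm⟩

/-- The signs are told apart modulo 4 and the indices `j₁` modulo `2^w`. -/
theorem cycResidues_injective {w t : ℕ} (ht : t + w + 3 ≤ k) {ε ε' : ℤ}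
    (hε : ε = 1 ∨ ε = -1) (hε' : ε' = 1 ∨ ε' = -1) {j j' : ℕ} (hj : j < 2 ^ w) (hj' : j' < 2 ^ w)
    (h : cycResidues k w t ε j = cycResidues k w t ε' j') : ε = ε' ∧ j = j' := by
  obtain ⟨m, hm⟩ : ∃ m, k = m + 2 + w + t + 1 := ⟨k - w - t - 3, by omega⟩
  have hmem : ((2 ^ (k - w - t - 1) + ε + 2 ^ (k - w - t) * j : ℤ) : ZMod (2 ^ k)) ∈
      cycResidues k w t ε' j' := by
    rw [← h, mem_cycResidues_iff (by omega), sub_self]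
    exact dvd_zero _
  rw [mem_cycResidues_iff (by omega), show k - w - t - 1 = m + 2 by omega,
    show k - w - t = m + 3 by omega, show k - t = m + 3 + w by omega] at hmem
  obtain ⟨q, hq⟩ := hmem
  have hεε : ε = ε' := by
    have : ε - ε' = 4 * (2 ^ m * (2 * 2 ^ w * q + 2 * j' - 2 * j)) := by
      linear_combination hq
    rcases hε with rfl | rfl <;> rcases hε' with rfl | rfl <;> omega
  subst hεε
  refine ⟨rfl, ?_⟩
  have hjj : (j : ℤ) - j' = 2 ^ w * q := by
    have h2 : (2 : ℤ) ^ (m + 3) ≠ 0 := by positivity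
    apply mul_left_cancel₀ h2
    linear_combination hq
  have hmod : j' ≡ j [MOD 2 ^ w] := (Nat.modEq_iff_dvd).2 ⟨q, by push_cast; exact hjj⟩
  exact (hmod.eq_of_lt_of_lt hj' hj).symm

theorem encard_cyclesIn_two_pow (hn : 1 < n) (hodd : Odd n) {t : ℕ} (ht₁ : 1 ≤ t)
    (ht : t + wExp n + 3 ≤ k) :
    (cyclesIn (chebGraph n k) (oddStates k) (2 ^ t)).encard = (2 ^ (wExp n + 1) : ℕ) := by
  have himage : cyclesIn (chebGraph n k) (oddStates k) (2 ^ t) =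
      (fun p : ℤ × ℕ => cycResidues k (wExp n) t p.1 p.2) ''
        ((({1, -1} : Finset ℤ) ×ˢ Finset.range (2 ^ wExp n) : Finset (ℤ × ℕ)) : Set (ℤ × ℕ)) := by
    rw [cyclesIn_two_pow hn hodd ht₁ ht]
    ext C
    constructor
    · rintro ⟨ε, hε, j, hj, rfl⟩
      exact ⟨(ε, j), by simpa using ⟨hε, hj⟩, rfl⟩
    · rintro ⟨⟨ε, j⟩, hp, rfl⟩
      have hp' : (ε = 1 ∨ ε = -1) ∧ j < 2 ^ wExp n := by simpa using hp
      exact ⟨ε, hp'.1, j, hp'.2, rfl⟩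
  rw [himage, Set.InjOn.encard_image, Set.encard_coe_eq_coe_finsetCard, Finset.card_product,
    Finset.card_range, pow_succ', Finset.card_pair (by norm_num)]
  rintro ⟨ε, j⟩ hp ⟨ε', j'⟩ hp' h
  have h₁ : (ε = 1 ∨ ε = -1) ∧ j < 2 ^ wExp n := by simpa using hp
  have h₂ : (ε' = 1 ∨ ε' = -1) ∧ j' < 2 ^ wExp n := by simpa using hp'
  obtain ⟨rfl, rfl⟩ := cycResidues_injective ht h₁.1 h₂.1 h₁.2 h₂.2 h
  rfl

/-! ### Self-loops -/

theorem cyclesIn_one (hn : 1 < n) (hodd : Odd n) (hk : 1 ≤ k) :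
    cyclesIn (chebGraph n k) (oddStates k) 1 =
      {C | ∃ x ∈ oddStates k, IsFixedPt (chebMap n k) x ∧ C = {x}} :=
  cyclesIn_functionalGraph_one (chebMap_mem_oddStates_iff hodd hk)
    (mem_periodicPts_of_mem_oddStates hn hodd hk)

/-- The odd fixed points are the states congruent to `±1` modulo `2^(k-w-1)`. -/
theorem isFixedPt_iff_exists (hn : 1 < n) (hodd : Odd n) (hk : wExp n + 3 ≤ k)
    {x : ZMod (2 ^ k)} :
    x ∈ oddStates k ∧ IsFixedPt (chebMap n k) x ↔
      ∃ ε : ℤ, (ε = 1 ∨ ε = -1) ∧ ∃ q : ℤ,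
        x = ((ε + 2 ^ (k - wExp n - 1) * q : ℤ) : ZMod (2 ^ k)) := by
  have hfix : ∀ y : ZMod (2 ^ k),
      IsFixedPt (chebMap n k) y ↔ IsPeriodicPt (chebMap n k) (2 ^ 0) y := fun y => Iff.rfl
  obtain ⟨m, hm⟩ : ∃ m, k = m + wExp n + 3 := ⟨k - wExp n - 3, by omega⟩
  have hkm : k - wExp n - 1 = m + 2 := by omega
  constructor
  · rintro ⟨hx, hxf⟩
    obtain ⟨x, rfl⟩ := ZMod.intCast_surjective x
    rw [intCast_mem_oddStates (by omega)] at hx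
    obtain ⟨ε, hε, h4⟩ := exists_sign_four_dvd_sub hx
    rw [hfix, isPeriodicPt_intCast_iff_dvd_sub hn hodd hε h4 (by omega), Nat.sub_zero] at hxf
    obtain ⟨q, hq⟩ := hxf
    exact ⟨ε, hε, q, by rw [← hq, add_sub_cancel]⟩
  · rintro ⟨ε, hε, q, rfl⟩
    have hq : ε + 2 ^ (m + 2) * q - ε = 2 ^ (m + 2) * q := by ring
    have h4 : 4 ∣ ε + 2 ^ (m + 2) * q - ε := ⟨2 ^ m * q, by rw [hq]; ring⟩
    rw [hkm]
    refine ⟨?_, ?_⟩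
    · rw [intCast_mem_oddStates (by omega), Int.odd_iff]
      omega
    · rw [hfix, isPeriodicPt_intCast_iff_dvd_sub hn hodd hε h4 (by omega), Nat.sub_zero, hkm, hq]
      exact dvd_mul_right _ _

theorem mem_loopResidues_iff {w : ℕ} (hk : w + 1 ≤ k) {x : ZMod (2 ^ k)} :
    x ∈ loopResidues k w ↔ ∃ ε : ℤ, (ε = 1 ∨ ε = -1) ∧ ∃ q : ℤ,
      x = ((ε + 2 ^ (k - w - 1) * q : ℤ) : ZMod (2 ^ k)) := by
  constructor
  · rintro ⟨j, -, rfl | rfl⟩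
    · exact ⟨1, .inl rfl, j, rfl⟩
    · exact ⟨-1, .inr rfl, j + 1, by congr 1; ring⟩
  · rintro ⟨ε, rfl | rfl, q, rfl⟩
    · obtain ⟨j, hj, h⟩ := exists_lt_two_pow_mul_eq hk q
      rw [← Nat.sub_sub] at h
      refine ⟨j, by exact_mod_cast hj, .inl ?_⟩
      rw [Int.cast_add, h, ← Int.cast_add]
    · -- here the residues are indexed with `j + 1` in place of `j`
      obtain ⟨j, hj, h⟩ := exists_lt_two_pow_mul_eq hk (q - 1)
      rw [← Nat.sub_sub] at h
      refine ⟨j, by exact_mod_cast hj, .inr ?_⟩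
      rw [show (-1 + 2 ^ (k - w - 1) * q : ℤ) =
          2 ^ (k - w - 1) * (q - 1) + (2 ^ (k - w - 1) - 1) by ring, Int.cast_add, h,
        ← Int.cast_add]
      congr 1
      ring

theorem cyclesIn_one_eq_loopResidues (hn : 1 < n) (hodd : Odd n) (hk : wExp n + 3 ≤ k) :
    cyclesIn (chebGraph n k) (oddStates k) 1 =
      {C | ∃ x ∈ loopResidues k (wExp n), C = {x}} := by
  rw [cyclesIn_one hn hodd (by omega)]
  ext C
  refine exists_congr fun x => ?_
  rw [← and_assoc, isFixedPt_iff_exists hn hodd hk, mem_loopResidues_iff (by omega)]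

theorem encard_loopResidues {w : ℕ} (hk : w + 3 ≤ k) :
    (loopResidues k w).encard = (2 ^ (w + 2) : ℕ) := by
  obtain ⟨m, hm⟩ : ∃ m, k = m + w + 3 := ⟨k - w - 3, by omega⟩
  have hkm : k - w - 1 = m + 2 := by omega
  have himage : loopResidues k w =
      (fun p : ℤ × ℕ => ((p.1 + 2 ^ (m + 2) * p.2 : ℤ) : ZMod (2 ^ k))) ''
        ((({1, -1} : Finset ℤ) ×ˢ Finset.range (2 ^ (w + 1)) : Finset (ℤ × ℕ)) :
          Set (ℤ × ℕ)) := by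
    ext x
    rw [mem_loopResidues_iff (by omega), hkm]
    constructor
    · rintro ⟨ε, hε, q, rfl⟩
      obtain ⟨j, hj, h⟩ := exists_lt_two_pow_mul_eq (show w + 1 ≤ k by omega) q
      rw [← Nat.sub_sub, hkm] at h
      refine ⟨(ε, j), by simpa using ⟨hε, hj⟩, ?_⟩
      simp only
      rw [Int.cast_add, ← h, ← Int.cast_add]
    · rintro ⟨⟨ε, j⟩, hp, rfl⟩
      have hp' : (ε = 1 ∨ ε = -1) ∧ j < 2 ^ (w + 1) := by simpa using hp
      exact ⟨ε, hp'.1, j, rfl⟩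
  rw [himage, Set.InjOn.encard_image, Set.encard_coe_eq_coe_finsetCard, Finset.card_product,
    Finset.card_range, pow_succ' 2 (w + 1), Finset.card_pair (by norm_num)]
  rintro ⟨ε, j⟩ hp ⟨ε', j'⟩ hp' h
  have h₁ : (ε = 1 ∨ ε = -1) ∧ j < 2 ^ (w + 1) := by simpa using hp
  have h₂ : (ε' = 1 ∨ ε' = -1) ∧ j' < 2 ^ (w + 1) := by simpa using hp'
  simp only at h
  rw [ZMod.intCast_eq_intCast_iff_dvd_sub] at h
  obtain ⟨q, hq⟩ := h
  push_cast at hq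
  rw [show k = m + 2 + (w + 1) by omega, pow_add] at hq
  obtain rfl : ε = ε' := by
    have : ε' - ε = 4 * (2 ^ m * (2 ^ (w + 1) * q - j' + j)) := by linear_combination hq
    rcases h₁.1 with rfl | rfl <;> rcases h₂.1 with rfl | rfl <;> omega
  have hjj : (j' : ℤ) - j = 2 ^ (w + 1) * q := by
    have h2 : (2 : ℤ) ^ (m + 2) ≠ 0 := by positivity
    apply mul_left_cancel₀ h2
    linear_combination hq
  have hmod : j ≡ j' [MOD 2 ^ (w + 1)] := (Nat.modEq_iff_dvd).2 ⟨q, by push_cast; exact hjj⟩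
  rw [hmod.eq_of_lt_of_lt h₁.2 h₂.2]

theorem encard_setOf_singleton {V : Type*} (S : Set V) :
    {C : Set V | ∃ x ∈ S, C = {x}}.encard = S.encard := by
  have : {C : Set V | ∃ x ∈ S, C = {x}} = (fun x => ({x} : Set V)) '' S := by
    ext C
    exact exists_congr fun x => and_congr_right fun _ => eq_comm
  rw [this, Set.singleton_injective.encard_image]

theorem encard_oddStates (hk : 1 ≤ k) : (oddStates k).encard = (2 ^ (k - 1) : ℕ) := by
  obtain ⟨l, rfl⟩ : ∃ l, k = l + 1 := ⟨k - 1, by omega⟩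
  have hlt : ∀ j < 2 ^ l, 2 * j + 1 < 2 ^ (l + 1) := fun j hj => by rw [pow_succ]; omega
  have himage : oddStates (l + 1) = (fun j : ℕ => ((2 * j + 1 : ℕ) : ZMod (2 ^ (l + 1)))) ''
      (Finset.range (2 ^ l) : Set ℕ) := by
    ext x
    constructor
    · rintro ⟨j, hj⟩
      refine ⟨j, ?_, ?_⟩
      · have := ZMod.val_lt x
        rw [hj, pow_succ] at this
        simp only [Finset.coe_range, Set.mem_Iio]
        omega
      · simp only
        rw [← hj, ZMod.natCast_zmod_val]
    · rintro ⟨j, hj, rfl⟩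
      rw [Finset.coe_range, Set.mem_Iio] at hj
      change Odd (ZMod.val _)
      rw [ZMod.val_cast_of_lt (hlt j hj)]
      exact odd_two_mul_add_one j
  rw [himage, Set.InjOn.encard_image, Set.encard_coe_eq_coe_finsetCard, Finset.card_range,
    Nat.add_sub_cancel]
  intro i hi j hj h
  rw [Finset.coe_range, Set.mem_Iio] at hi hj
  have := congrArg ZMod.val h
  simp only [ZMod.val_cast_of_lt (hlt _ hi), ZMod.val_cast_of_lt (hlt _ hj)] at this
  omega

/-! ### The multiset of cycle lengths -/

theorem exists_eq_two_pow_of_cyclesIn_nonempty (hn : 1 < n) (hodd : Odd n) (hk : 1 ≤ k) {L : ℕ}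
    (h : (cyclesIn (chebGraph n k) (oddStates k) L).Nonempty) :
    ∃ t ≤ k - wExp n - 3, L = 2 ^ t := by
  rw [chebGraph, cyclesIn_functionalGraph (chebMap_mem_oddStates_iff hodd hk)
    (mem_periodicPts_of_mem_oddStates hn hodd hk)] at h
  obtain ⟨-, x, hx, rfl, -⟩ := h
  exact (Nat.dvd_prime_pow Nat.prime_two).1
    (isPeriodicPt_of_mem_oddStates hn hodd hk hx).minimalPeriod_dvd

theorem isCycleUnion_oddStates_iff (hn : 1 < n) (hodd : Odd n) (hk : 1 ≤ k) (M : Multiset ℕ) :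
    IsCycleUnion (chebGraph n k) (oddStates k) M ↔
      ∀ L, (cyclesIn (chebGraph n k) (oddStates k) L).encard = (M.count L : ℕ∞) :=
  and_iff_right fun _ hx => exists_mem_cyclesIn (chebMap_mem_oddStates_iff hodd hk)
    (mem_periodicPts_of_mem_oddStates hn hodd hk) hx

theorem count_sum_replicate_two_pow (s : Finset ℕ) (c t : ℕ) :
    (∑ i ∈ s, Multiset.replicate c (2 ^ i)).count (2 ^ t) = if t ∈ s then c else 0 := by
  simp [Multiset.count_sum', Multiset.count_replicate]

theorem isCycleUnion_of_le (hn : 1 < n) (hodd : Odd n) (hk : wExp n + 3 ≤ k) :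
    IsCycleUnion (chebGraph n k) (oddStates k)
      ((∑ t ∈ Finset.Icc 1 (k - wExp n - 3), Multiset.replicate (2 ^ (wExp n + 1)) (2 ^ t)) +
        Multiset.replicate (2 ^ (wExp n + 2)) 1) := by
  rw [isCycleUnion_oddStates_iff hn hodd (by omega)]
  intro L
  rw [Multiset.count_add, Multiset.count_replicate]
  rcases (cyclesIn (chebGraph n k) (oddStates k) L).eq_empty_or_nonempty with he | hne
  · rw [he, Set.encard_empty, eq_comm, Nat.cast_eq_zero, Nat.add_eq_zero_iff]
    constructor
    · rw [Multiset.count_eq_zero, Multiset.mem_sum]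
      rintro ⟨t, ht, hL⟩
      rw [Finset.mem_Icc] at ht
      have := encard_cyclesIn_two_pow hn hodd ht.1 (show t + wExp n + 3 ≤ k by omega)
      rw [← Multiset.eq_of_mem_replicate hL, he, Set.encard_empty, eq_comm, Nat.cast_eq_zero]
        at this
      exact absurd this (by positivity)
    · rw [if_neg]
      rintro rfl
      have := encard_loopResidues hk
      rw [← encard_setOf_singleton, ← cyclesIn_one_eq_loopResidues hn hodd hk, he,
        Set.encard_empty, eq_comm, Nat.cast_eq_zero] at this
      exact absurd this (by positivity)
  · obtain ⟨t, ht, rfl⟩ := exists_eq_two_pow_of_cyclesIn_nonempty hn hodd (by omega) hne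
    rw [count_sum_replicate_two_pow]
    rcases Nat.eq_zero_or_pos t with rfl | ht₁
    · rw [pow_zero, cyclesIn_one_eq_loopResidues hn hodd hk, encard_setOf_singleton,
        encard_loopResidues hk]
      simp
    · rw [encard_cyclesIn_two_pow hn hodd ht₁ (by omega), if_pos (Finset.mem_Icc.2 ⟨ht₁, ht⟩),
        if_neg (Nat.one_lt_two_pow (by omega)).ne, add_zero]

theorem isFixedPt_of_lt (hn : 1 < n) (hodd : Odd n) (hk : 1 ≤ k) (hkw : k < wExp n + 3)
    {x : ZMod (2 ^ k)} (hx : x ∈ oddStates k) : IsFixedPt (chebMap n k) x := by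
  have h := isPeriodicPt_of_mem_oddStates hn hodd hk hx
  rwa [show k - wExp n - 3 = 0 by omega] at h

theorem isCycleUnion_of_lt (hn : 1 < n) (hodd : Odd n) (hk : 1 ≤ k) (hkw : k < wExp n + 3) :
    IsCycleUnion (chebGraph n k) (oddStates k) (Multiset.replicate (2 ^ (k - 1)) 1) := by
  rw [isCycleUnion_oddStates_iff hn hodd hk]
  intro L
  have hone : (cyclesIn (chebGraph n k) (oddStates k) 1).encard = (2 ^ (k - 1) : ℕ) := by
    rw [cyclesIn_one hn hodd hk, ← encard_oddStates hk, ← encard_setOf_singleton (oddStates k)]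
    exact congrArg Set.encard (Set.ext fun C => exists_congr fun x => and_congr_right fun hx =>
      and_iff_right (isFixedPt_of_lt hn hodd hk hkw hx))
  rw [Multiset.count_replicate]
  split_ifs with hL
  · rw [← hL, hone]
  · rw [Nat.cast_zero, Set.encard_eq_zero]
    by_contra hne
    obtain ⟨t, ht, rfl⟩ :=
      exists_eq_two_pow_of_cyclesIn_nonempty hn hodd hk (Set.nonempty_iff_ne_empty.2 hne)
    obtain rfl : t = 0 := by omega
    exact hL (pow_zero 2).symm

end

end ChebGraph

theorem mainTheorem1 (n k : ℕ) (hn : 1 < n) (hodd : Odd n) (hk : 1 ≤ k) :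
    (ChebGraph.wExp n + 3 ≤ k →
      ChebGraph.IsCycleUnion (ChebGraph.chebGraph n k) (ChebGraph.oddStates k)
        ((∑ t ∈ Finset.Icc 1 (k - ChebGraph.wExp n - 3),
            Multiset.replicate (2 ^ (ChebGraph.wExp n + 1)) (2 ^ t)) +
          Multiset.replicate (2 ^ (ChebGraph.wExp n + 2)) 1) ∧
      (∀ t ∈ Finset.Icc 1 (k - ChebGraph.wExp n - 3),
        ChebGraph.cyclesIn (ChebGraph.chebGraph n k) (ChebGraph.oddStates k) (2 ^ t) =
          {C | ∃ ε : ℤ, (ε = 1 ∨ ε = -1) ∧ ∃ j₁ < 2 ^ ChebGraph.wExp n,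
            C = ChebGraph.cycResidues k (ChebGraph.wExp n) t ε j₁}) ∧
      ChebGraph.cyclesIn (ChebGraph.chebGraph n k) (ChebGraph.oddStates k) 1 =
        {C | ∃ x ∈ ChebGraph.loopResidues k (ChebGraph.wExp n), C = {x}}) ∧
    (k < ChebGraph.wExp n + 3 →
      ChebGraph.IsCycleUnion (ChebGraph.chebGraph n k) (ChebGraph.oddStates k)
        (Multiset.replicate (2 ^ (k - 1)) 1) ∧
      ∀ x ∈ ChebGraph.oddStates k, ChebGraph.chebMap n k x = x) := by
  refine ⟨fun h => ⟨ChebGraph.isCycleUnion_of_le hn hodd h, fun t ht => ?_,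
    ChebGraph.cyclesIn_one_eq_loopResidues hn hodd h⟩,
    fun h => ⟨ChebGraph.isCycleUnion_of_lt hn hodd hk h,
      fun x hx => ChebGraph.isFixedPt_of_lt hn hodd hk h hx⟩⟩
  rw [Finset.mem_Icc] at ht
  exact ChebGraph.cyclesIn_two_pow hn hodd ht.1 (by omega)
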